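/- Let $E$ be a Polish space with Borel $\sigma$-algebra $\mathcal E$, and let $d$ be a metric on the set $E$ such that $d:E\times E\to[0,\infty)$ is continuous for the given topology of $E$ ($d$ need be neither complete nor compatible with that topology). Let $P(x,\mathrm dy)$ be a Markov transition kernel on $(E,\mathcal E)$. For a probability measure $\mu$ on $E$ let $\mathbb P_\mu$ denote the law on $E^{\infty}=E^{\{0,1,2,\dots\}}$ of the Markov chain with transition kernel $P$ and initial distribution $\mu$, and write $\mathbb P_x=\mathbb P_{\delta_x}$. A probability measure $\mu$ on $E$ is invariant if $\mu(\mathrm dy)=\int_E P(x,\mathrm dy)\,\mu(\mathrm dx)$; an invariant probability measure $\mu$ is ergodic if the left shift on $E^\infty$ is ergodic with respect to $\mathbb P_\mu$. For probability measures $\mathbb P,\mathbb Q$ on $E^\infty$ let $\widehat C(\mathbb P,\mathbb Q)$ be the set of all probability measures $\xi$ on $E^\infty\times E^\infty$ whose first and second marginals are absolutely continuous with respect to $\mathbb P$ and $\mathbb Q$, respectively; write $(X,Y)=((X_i)_{i\ge0},(Y_i)_{i\ge0})$ for the canonical element of $E^\infty\times E^\infty$. Let $M\in\mathcal E$ be such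 that $\mu(M)>0$ for every invariant probability measure $\mu$, and suppose that for all $x,y\in M$ there exists $\alpha_{x,y}>0$ such that for every $\varepsilon>0$ there exists $\xi^{\varepsilon}_{x,y}\in\widehat C(\mathbb P_x,\mathbb P_y)$ with $$\limsup_{n\to\infty}\frac1n\sum_{i=0}^{n-1}\xi^{\varepsilon}_{x,y}\big(d(X_i,Y_i)\le\varepsilon\big)\ \ge\ \alpha_{x,y}.$$ Then there exists at most one invariant probability measure, and if one exists, it is ergodic. -/

import Mathlib

open MeasureTheory ProbabilityTheory Filter

noncomputable section

namespace GenCoupling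

/-- `d` is a metric on the set `E` which is continuous (as a function on `E × E`) for the given
topology of `E`.  It need be neither complete nor compatible with that topology. -/
structure IsContinuousMetric {E : Type*} [TopologicalSpace E] (d : E → E → ℝ) : Prop where
  nonneg : ∀ x y, 0 ≤ d x y
  eq_zero_iff : ∀ x y, d x y = 0 ↔ x = y
  symm : ∀ x y, d x y = d y x
  triangle : ∀ x y z, d x z ≤ d x y + d y z
  continuous : Continuous (fun p : E × E => d p.1 p.2)

variable {E : Type*} [MeasurableSpace E]

/-- The law on the trajectory space `ℕ → E` of the Markov chain with transition kernel `P` and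
initial distribution `μ`: given the first `n + 1` states `X₀, …, Xₙ`, the next state is drawn from
`P(Xₙ, ·)`. -/
def chainLaw (P : Kernel E E) [IsMarkovKernel P] (μ : Measure E) : Measure (ℕ → E) :=
  Kernel.trajMeasure (X := fun _ : ℕ => E) μ
    (fun n : ℕ => P.comap
      (fun x : (i : Finset.Iic n) → E => x ⟨n, Finset.mem_Iic.2 le_rfl⟩)
      (measurable_pi_apply _))

/-- The left shift on the trajectory space. -/
def shift (ω : ℕ → E) : ℕ → E := fun n => ω (n + 1)

/-- `μ` is an invariant probability measure of the chain with transition kernel `P`. -/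
def IsInvariantProb (P : Kernel E E) (μ : Measure E) : Prop :=
  IsProbabilityMeasure μ ∧ Kernel.Invariant P μ

/-- The generalized couplings of `μ` and `ν`: probability measures on the product space whose
marginals are absolutely continuous with respect to `μ` and `ν`. -/
def generalizedCouplings {S : Type*} [MeasurableSpace S] (μ ν : Measure S) :
    Set (Measure (S × S)) :=
  {ξ | IsProbabilityMeasure ξ ∧ ξ.map Prod.fst ≪ μ ∧ ξ.map Prod.snd ≪ ν}

end GenCoupling

end

/-! It suffices to show that every invariant probability measure is ergodic: two invariant measures
are absolutely continuous with respect to their midpoint, and an ergodic law dominates no other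
invariant law.

Let `A` be a shift-invariant event. By Lévy's zero-one law `P_{Xₙ}(A) → 1_A` almost surely, and by
Poincaré recurrence this forces `P_{X₀}(A) = 1_A` under a stationary law, so `P_x(A) ∈ {0, 1}` for
`μ`-almost every `x`. If `μ` is not ergodic, the absorbing sets `{x | P_x(A) = 1}` and
`{x | P_x(Aᶜ) = 1}` both have positive measure for some `A`, and conditioning `μ` on them gives two
mutually singular invariant measures.

Let `σ` and `ρ` be such measures, carried by disjoint sets, and let `c > 0`. Choose compact subsets
`K` and `L` of these sets exhausting `σ` and `ρ` up to a small error. By the maximal ergodic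
inequality the stationary chain spends more than a fraction `c` of its time outside `K` with small
probability only, and since this event is shift-invariant, the zero-one law upgrades this to
probability zero for suitable starting points. A generalized coupling of chains confined to `K` and
to `L` in this sense brings them within `ε = min_{K × L} d / 2` of each other at most a fraction
`2c` of the time, which contradicts the coupling hypothesis as soon as `2c < α`. -/

open scoped ENNReal NNReal Topology

namespace GenCoupling

section MaximalErgodic

variable {Ω : Type*}

theorem partialSups_birkhoffSum_sub_comp_le (T : Ω → Ω) (f : Ω → ℝ) (n : ℕ) (ω : Ω) :
    partialSups (birkhoffSum T f) n ω - partialSups (birkhoffSum T f) n (T ω) ≤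
      {ω | 0 < partialSups (birkhoffSum T f) n ω}.indicator f ω := by
  have birkhoffSum_le (k : ℕ) (hk : k ≤ n) (ω : Ω) :
      birkhoffSum T f k ω ≤ partialSups (birkhoffSum T f) n ω :=
    le_partialSups_of_le (birkhoffSum T f) hk ω
  by_cases hpos : 0 < partialSups (birkhoffSum T f) n ω
  · rw [Set.indicator_of_mem (show ω ∈ {ω | 0 < partialSups (birkhoffSum T f) n ω} from hpos)]
    obtain ⟨k, hkn, hk⟩ := exists_partialSups_eq (fun k => birkhoffSum T f k ω) n
    rw [Pi.partialSups_apply, hk] at hpos ⊢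
    obtain _ | k := k
    · simp at hpos
    · linarith [birkhoffSum_succ' T f k ω, birkhoffSum_le k (by omega) (T ω)]
  · rw [Set.indicator_of_notMem (show ω ∉ {ω | 0 < partialSups (birkhoffSum T f) n ω} from hpos)]
    linarith [birkhoffSum_le 0 (Nat.zero_le n) (T ω), birkhoffSum_zero T f (T ω)]

variable [MeasurableSpace Ω] {Q : Measure Ω} {T : Ω → Ω} {f : Ω → ℝ}

theorem integrable_birkhoffSum (hT : MeasurePreserving T Q Q) (hf : Integrable f Q) (n : ℕ) :
    Integrable (birkhoffSum T f n) Q :=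
  integrable_finsetSum _ fun i _ => (hT.iterate i).integrable_comp_of_integrable hf

theorem integrable_partialSups_birkhoffSum (hT : MeasurePreserving T Q Q) (hf : Integrable f Q)
    (n : ℕ) : Integrable (partialSups (birkhoffSum T f) n) Q := by
  induction n with
  | zero => simp
  | succ n ih =>
    rw [← Order.succ_eq_add_one, partialSups_succ]
    exact ih.sup (integrable_birkhoffSum hT hf _)

theorem setIntegral_partialSups_birkhoffSum_nonneg (hT : MeasurePreserving T Q Q)
    (hf : Integrable f Q) (n : ℕ) :
    0 ≤ ∫ ω in {ω | 0 < partialSups (birkhoffSum T f) n ω}, f ω ∂Q := by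
  let m : Ω → ℝ := partialSups (birkhoffSum T f) n
  have hm : Integrable m Q := integrable_partialSups_birkhoffSum hT hf n
  have hmT : Integrable (fun ω => m (T ω)) Q := hT.integrable_comp_of_integrable hm
  have hpos : NullMeasurableSet {ω | 0 < m ω} Q :=
    nullMeasurableSet_lt aemeasurable_const hm.aemeasurable
  have integral_comp : ∫ ω, m (T ω) ∂Q = ∫ ω, m ω ∂Q := by
    rw [← integral_map hT.aemeasurable (by simpa only [hT.map_eq] using hm.1), hT.map_eq]
  calc
    0 = ∫ ω, m ω - m (T ω) ∂Q := by rw [integral_sub hm hmT, integral_comp, sub_self]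
    _ ≤ ∫ ω, {ω | 0 < m ω}.indicator f ω ∂Q :=
      integral_mono (hm.sub hmT) (hf.indicator₀ hpos)
        (partialSups_birkhoffSum_sub_comp_le T f n)
    _ = ∫ ω in {ω | 0 < m ω}, f ω ∂Q := integral_indicator₀ hpos

end MaximalErgodic

section UpperFrequency

variable {Ω : Type*} {T : Ω → Ω} {D : Set Ω}

/-- The upper asymptotic frequency of the visits of the orbit of `ω` under `T` to `D`. -/
noncomputable def upperFrequency (T : Ω → Ω) (D : Set Ω) (ω : Ω) : ℝ≥0∞ :=
  limsup (fun n : ℕ => birkhoffSum T (D.indicator 1) n ω / n) atTop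

theorem indicator_one_le_one (D : Set Ω) (ω : Ω) : D.indicator (1 : Ω → ℝ≥0∞) ω ≤ 1 :=
  Set.indicator_apply_le' (fun _ => le_rfl) fun _ => zero_le_one

theorem birkhoffSum_indicator_le (n : ℕ) (ω : Ω) :
    birkhoffSum T (D.indicator (1 : Ω → ℝ≥0∞)) n ω ≤ n := by
  simpa [birkhoffSum] using
    Finset.sum_le_card_nsmul (Finset.range n) _ 1 fun i _ => indicator_one_le_one D (T^[i] ω)

theorem toReal_birkhoffSum_indicator (n : ℕ) (ω : Ω) :
    (birkhoffSum T (D.indicator (1 : Ω → ℝ≥0∞)) n ω).toReal =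
      birkhoffSum T (D.indicator (1 : Ω → ℝ)) n ω := by
  rw [birkhoffSum, ENNReal.toReal_sum fun i _ =>
    ((indicator_one_le_one D (T^[i] ω)).trans_lt ENNReal.one_lt_top).ne]
  refine Finset.sum_congr rfl fun i _ => ?_
  by_cases h : T^[i] ω ∈ D <;> simp [h]

theorem upperFrequency_comp (T : Ω → Ω) (D : Set Ω) (ω : Ω) :
    upperFrequency T D (T ω) = upperFrequency T D ω := by
  have div_tendsto (b : ℕ → ℝ≥0∞) (hb : ∀ n, b n ≤ 1) :
      Tendsto (fun n : ℕ => b n / n) atTop (𝓝 0) :=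
    tendsto_of_tendsto_of_tendsto_of_le_of_le tendsto_const_nhds
      ENNReal.tendsto_inv_nat_nhds_zero (fun _ => zero_le) fun n => by
        simpa using ENNReal.div_le_div_right (hb n) n
  let S := birkhoffSum T (D.indicator (1 : Ω → ℝ≥0∞))
  calc
    limsup (fun n : ℕ => S n (T ω) / n) atTop
      = limsup (fun n : ℕ => D.indicator 1 ω / n + S n (T ω) / n) atTop :=
        (ENNReal.limsup_add_of_left_tendsto_zero
          (div_tendsto _ fun _ => indicator_one_le_one D ω) _).symm
    _ = limsup (fun n : ℕ => S n ω / n + D.indicator 1 (T^[n] ω) / n) atTop := by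
        simp only [← ENNReal.add_div, S, ← birkhoffSum_succ', ← birkhoffSum_succ]
    _ = limsup (fun n : ℕ => S n ω / n) atTop :=
        ENNReal.limsup_add_of_right_tendsto_zero
          (div_tendsto _ fun n => indicator_one_le_one D (T^[n] ω)) _

variable [MeasurableSpace Ω] {Q : Measure Ω}

theorem measurable_birkhoffSum_indicator (hT : Measurable T) (hD : MeasurableSet D) (n : ℕ) :
    Measurable (birkhoffSum T (D.indicator (1 : Ω → ℝ≥0∞)) n) :=
  Finset.measurable_sum _ fun i _ => (measurable_one.indicator hD).comp (hT.iterate i)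

theorem measurable_upperFrequency (hT : Measurable T) (hD : MeasurableSet D) :
    Measurable (upperFrequency T D) :=
  .limsup fun n => (measurable_birkhoffSum_indicator hT hD n).div_const _

theorem lintegral_birkhoffSum_indicator (hT : Measurable T) (hD : MeasurableSet D) (n : ℕ) :
    ∫⁻ ω, birkhoffSum T (D.indicator 1) n ω ∂Q = ∑ i ∈ Finset.range n, Q (T^[i] ⁻¹' D) := by
  simp only [birkhoffSum]
  rw [lintegral_finsetSum (Finset.range n) fun i _ =>
    show Measurable fun ω => D.indicator (1 : Ω → ℝ≥0∞) (T^[i] ω) from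
      (measurable_one.indicator hD).comp (hT.iterate i)]
  refine Finset.sum_congr rfl fun i _ => ?_
  rw [← lintegral_indicator_one (hT.iterate i hD)]
  rfl

theorem limsup_average_measure_le_lintegral_upperFrequency [IsFiniteMeasure Q]
    (hT : Measurable T) (hD : MeasurableSet D) :
    limsup (fun n : ℕ => (∑ i ∈ Finset.range n, Q (T^[i] ⁻¹' D)) / n) atTop ≤
      ∫⁻ ω, upperFrequency T D ω ∂Q := by
  refine le_trans (le_of_eq ?_) (limsup_lintegral_le 1
    (fun n => (measurable_birkhoffSum_indicator hT hD n).div_const n)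
    (fun n => ae_of_all _ fun ω => ?_) (by simp))
  · congr with n
    rw [← lintegral_birkhoffSum_indicator hT hD]
    simp only [div_eq_mul_inv]
    rw [lintegral_mul_const _ (measurable_birkhoffSum_indicator hT hD n)]
  · exact ENNReal.div_le_of_le_mul (by simpa using birkhoffSum_indicator_le n ω)

theorem mul_measure_lt_upperFrequency_le [IsFiniteMeasure Q] (hT : MeasurePreserving T Q Q)
    (hD : MeasurableSet D) (c : ℝ≥0) : c * Q {ω | c < upperFrequency T D ω} ≤ Q D := by
  let f : Ω → ℝ := D.indicator 1 - fun _ => (c : ℝ)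
  have hind : Integrable (D.indicator (1 : Ω → ℝ)) Q := (integrable_const 1).indicator hD
  have hf : Integrable f Q := hind.sub (integrable_const _)
  let A (n : ℕ) : Set Ω := {ω | 0 < partialSups (birkhoffSum T f) n ω}
  have hA : Monotone A := fun m n hmn ω hω =>
    lt_of_lt_of_le hω (partialSups_monotone (birkhoffSum T f) hmn ω)
  have subset_iUnion : {ω | c < upperFrequency T D ω} ⊆ ⋃ n, A n := by
    intro ω hω
    obtain ⟨n, hn⟩ := (frequently_lt_of_lt_limsup (by isBoundedDefault)
      (show (c : ℝ≥0∞) < limsup _ atTop from hω)).exists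
    have hsum : birkhoffSum T f n ω = birkhoffSum T (D.indicator (1 : Ω → ℝ)) n ω - n * c := by
      simp [f, birkhoffSum]
    have hlt : n * c < birkhoffSum T (D.indicator (1 : Ω → ℝ)) n ω := by
      simpa [toReal_birkhoffSum_indicator, mul_comm] using
        ENNReal.toReal_strict_mono
          ((birkhoffSum_indicator_le n ω).trans_lt (ENNReal.natCast_lt_top n)).ne
          (ENNReal.mul_lt_of_lt_div hn)
    exact Set.mem_iUnion.2 ⟨n, (sub_pos.2 hlt).trans_le
      (hsum ▸ le_partialSups (birkhoffSum T f) n ω)⟩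
  have measure_le (n : ℕ) : c * Q (A n) ≤ Q D := by
    have hint : ∫ ω in A n, f ω ∂Q = Q.real (D ∩ A n) - c * Q.real (A n) := by
      rw [integral_sub' hind.restrict (integrable_const _),
        integral_indicator_one hD, measureReal_restrict_apply hD]
      simp [mul_comm]
    have hle : c * Q.real (A n) ≤ Q.real D := by
      linarith [setIntegral_partialSups_birkhoffSum_nonneg hT hf n,
        measureReal_mono (μ := Q) (Set.inter_subset_left : D ∩ A n ⊆ D)]
    exact (ENNReal.toReal_le_toReal (by finiteness) (by finiteness)).1
      (by simpa [measureReal_def] using hle)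
  calc
    c * Q {ω | c < upperFrequency T D ω} ≤ c * Q (⋃ n, A n) := by gcongr
    _ = ⨆ n, c * Q (A n) := by rw [hA.measure_iUnion, ENNReal.mul_iSup]
    _ ≤ Q D := iSup_le measure_le

end UpperFrequency
section Recurrence

variable {Ω X : Type*} [MeasurableSpace Ω] {T : Ω → Ω} {Q : Measure Ω}
  [TopologicalSpace X] [T2Space X] [SecondCountableTopology X] [MeasurableSpace X]
  [OpensMeasurableSpace X]

theorem ae_eq_of_conservative_of_tendsto_iterate (hT : Conservative T Q) {g y : Ω → X}
    (hg : Measurable g) (hlim : ∀ᵐ ω ∂Q, Tendsto (fun n => g (T^[n] ω)) atTop (𝓝 (y ω))) :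
    g =ᵐ[Q] y := by
  have hrec : ∀ U ∈ TopologicalSpace.countableBasis X,
      ∀ᵐ ω ∂Q, ω ∈ g ⁻¹' U → ∃ᶠ n in atTop, T^[n] ω ∈ g ⁻¹' U := fun U hU =>
    hT.ae_mem_imp_frequently_image_mem
      (hg (TopologicalSpace.isOpen_of_mem_countableBasis hU).measurableSet).nullMeasurableSet
  filter_upwards [hlim,
    (ae_ball_iff (TopologicalSpace.countable_countableBasis X)).2 hrec] with ω hω hrecω
  have hcluster : MapClusterPt (g ω) atTop fun n => g (T^[n] ω) := by
    rw [(TopologicalSpace.isBasis_countableBasis X).nhds_hasBasis.mapClusterPt_iff_frequently]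
    exact fun U hU => hrecω U hU.1 hU.2
  exact eq_of_nhds_neBot (hcluster.clusterPt.mono hω)

end Recurrence

section Chain

open Preorder

variable {E : Type*}

theorem shift_iterate_apply (n : ℕ) (ω : ℕ → E) (i : ℕ) : shift^[n] ω i = ω (i + n) := by
  induction n generalizing ω with
  | zero => rfl
  | succ n ih => rw [Function.iterate_succ_apply, ih, shift, add_assoc]

variable [MeasurableSpace E]

theorem measurable_shift : Measurable (shift (E := E)) :=
  measurable_pi_lambda _ fun n => measurable_pi_apply (n + 1)

theorem ext_of_map_frestrictLe {Q R : Measure (ℕ → E)} [IsFiniteMeasure Q]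
    (h : ∀ n, Q.map (frestrictLe (π := fun _ : ℕ => E) n) = R.map (frestrictLe n)) : Q = R := by
  have hQ : IsProjectiveLimit Q fun I => Q.map I.restrict := fun _ => rfl
  have hR : IsProjectiveLimit R fun I => Q.map I.restrict :=
    (isProjectiveLimit_nat_iff' (isProjectiveMeasureFamily_map_restrict fun t =>
      (measurable_pi_apply t).aemeasurable) R 0).2 fun n _ => (h n).symm
  exact hQ.unique hR

/-- The transition kernel `P` as a kernel on the histories up to time `n`: the next state depends on
the last state only. -/
noncomputable abbrev historyKernel (P : Kernel E E) (n : ℕ) : Kernel (Finset.Iic n → E) E :=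
  P.comap (fun x => x ⟨n, Finset.mem_Iic.2 le_rfl⟩) (measurable_pi_apply _)

/-- Under `Q`, the trajectory is a Markov chain with transition kernel `P` from time `n` on. The
behaviour before time `n` is arbitrary, so that the law of the chain conditioned on its history up
to time `n` is an instance. -/
def IsMarkovFrom (P : Kernel E E) (n : ℕ) (Q : Measure (ℕ → E)) : Prop :=
  ∀ a, n ≤ a → HasCondDistrib (fun ω => ω (a + 1)) (frestrictLe (π := fun _ : ℕ => E) a)
    (historyKernel P a) Q

variable {P : Kernel E E} {Q R : Measure (ℕ → E)} {n : ℕ}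

theorem IsMarkovFrom.ext [IsFiniteMeasure Q] (hQ : IsMarkovFrom P 0 Q) (hR : IsMarkovFrom P 0 R)
    (h0 : Q.map (fun ω => ω 0) = R.map (fun ω => ω 0)) : Q = R := by
  refine ext_of_map_frestrictLe fun n => ?_
  induction n with
  | zero =>
    let e : E ≃ᵐ (Finset.Iic 0 → E) := (MeasurableEquiv.piUnique fun _ => E).symm
    have he : frestrictLe (π := fun _ : ℕ => E) 0 = e ∘ fun ω => ω 0 := by
      ext ω ⟨i, hi⟩
      obtain rfl : i = 0 := by simpa using hi
      rfl
    rw [he, ← Measure.map_map e.measurable (measurable_pi_apply 0),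
      ← Measure.map_map e.measurable (measurable_pi_apply 0), h0]
  | succ a ih =>
    let glue : (Finset.Iic a → E) × E → Finset.Iic (a + 1) → E :=
      IicProdIoc (X := fun _ => E) a (a + 1) ∘
        Prod.map id (MeasurableEquiv.piSingleton (X := fun _ => E) a)
    have hglue : Measurable glue :=
      measurable_IicProdIoc.comp (measurable_id.prodMap (MeasurableEquiv.measurable _))
    have hsucc : frestrictLe (π := fun _ : ℕ => E) (a + 1) =
        glue ∘ fun ω => (frestrictLe (π := fun _ : ℕ => E) a ω, ω (a + 1)) := by
      ext ω ⟨i, hi⟩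
      obtain h | rfl := Nat.le_succ_iff.1 (Finset.mem_Iic.1 hi)
      · simp [glue, IicProdIoc, h]
      · simp [glue, IicProdIoc, MeasurableEquiv.piSingleton]
    rw [hsucc, ← Measure.map_map hglue (by fun_prop), ← Measure.map_map hglue (by fun_prop),
      (hQ a (Nat.zero_le a)).map_eq, (hR a (Nat.zero_le a)).map_eq, ih]

theorem IsMarkovFrom.map_shift_iterate [SFinite Q] [IsSFiniteKernel P] (hQ : IsMarkovFrom P n Q) :
    IsMarkovFrom P 0 (Q.map shift^[n]) := by
  intro a _
  let drop (x : Finset.Iic (a + n) → E) (i : Finset.Iic a) : E :=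
    x ⟨i + n, Finset.mem_Iic.2 (Nat.add_le_add_right (Finset.mem_Iic.1 i.2) n)⟩
  have hdrop : Measurable drop := measurable_pi_lambda _ fun i => measurable_pi_apply _
  have hcond : HasCondDistrib (fun ω => ω (a + n + 1))
      (drop ∘ frestrictLe (π := fun _ : ℕ => E) (a + n)) (historyKernel P a) Q :=
    HasCondDistrib.comp_right (hf := hdrop) (hQ (a + n) (Nat.le_add_left n a))
  have hfrestrict : drop ∘ frestrictLe (π := fun _ : ℕ => E) (a + n) =
      frestrictLe (π := fun _ : ℕ => E) a ∘ shift^[n] := by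
    ext ω i
    simp [drop, shift_iterate_apply]
  refine ⟨by fun_prop, ?_⟩
  rw [Measure.map_map (by fun_prop) (measurable_shift.iterate n),
    Measure.map_map (by fun_prop) (measurable_shift.iterate n), ← hfrestrict, ← hcond.map_eq]
  congr with ω
  · simp [drop, shift_iterate_apply]
  · simp [shift_iterate_apply, add_right_comm]

theorem IsMarkovFrom.map_eval_succ [SFinite Q] [IsSFiniteKernel P] (hQ : IsMarkovFrom P n Q) :
    Q.map (fun ω => ω (n + 1)) = (Q.map fun ω => ω n).bind P := by
  have hcond : HasCondDistrib (fun ω => ω (n + 1)) (fun ω => ω n) P Q := (hQ n le_rfl).comp_right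
  rw [← Measure.snd_map_prodMk (measurable_pi_apply n), hcond.map_eq, Measure.snd_compProd]

variable (P) [IsMarkovKernel P]

instance (μ : Measure E) [IsProbabilityMeasure μ] : IsProbabilityMeasure (chainLaw P μ) := by
  unfold chainLaw; infer_instance

theorem isMarkovFrom_chainLaw (μ : Measure E) [IsProbabilityMeasure μ] :
    IsMarkovFrom P 0 (chainLaw P μ) := fun _ _ =>
  ⟨by fun_prop, Kernel.map_frestrictLe_trajMeasure_compProd_eq_map_trajMeasure.symm⟩

theorem isMarkovFrom_traj (n : ℕ) (x : Finset.Iic n → E) :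
    IsMarkovFrom P n (Kernel.traj (X := fun _ : ℕ => E) (historyKernel P) n x) := fun a ha =>
  ⟨by fun_prop, by
    rw [Kernel.traj_map_frestrictLe_apply, Kernel.partialTraj_compProd_eq_map_traj ha]⟩

/-- The law of the chain as a kernel in the starting point. It agrees with `x ↦ chainLaw P δₓ`
(`chainLaw_dirac`) and additionally carries the measurability in `x`. -/
noncomputable def chainKernel : Kernel E (ℕ → E) :=
  (Kernel.traj (X := fun _ : ℕ => E) (historyKernel P) 0).comap
    (MeasurableEquiv.piUnique fun _ : Finset.Iic 0 => E).symm (MeasurableEquiv.measurable _)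

instance : IsMarkovKernel (chainKernel P) := by unfold chainKernel; infer_instance

theorem chainLaw_eq_bind (μ : Measure E) : chainLaw P μ = μ.bind (chainKernel P) := by
  rw [chainLaw, Kernel.trajMeasure, chainKernel, ← Kernel.comp_deterministic_eq_comap,
    ← Measure.comp_assoc, Measure.deterministic_comp_eq_map]

theorem chainLaw_dirac (x : E) : chainLaw P (Measure.dirac x) = chainKernel P x := by
  rw [chainLaw_eq_bind, Measure.dirac_bind (Kernel.measurable _)]

theorem map_eval_traj (n : ℕ) (x : Finset.Iic n → E) :
    (Kernel.traj (X := fun _ : ℕ => E) (historyKernel P) n x).map (fun ω => ω n) =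
      Measure.dirac (x ⟨n, Finset.mem_Iic.2 le_rfl⟩) := by
  have hlast : Measurable fun y : Finset.Iic n → E => y ⟨n, Finset.mem_Iic.2 le_rfl⟩ :=
    measurable_pi_apply _
  rw [← Measure.map_dirac' hlast, ← Kernel.id_apply x,
    ← Kernel.partialTraj_self (X := fun _ : ℕ => E) (κ := historyKernel P),
    ← Kernel.traj_map_frestrictLe_apply, Measure.map_map hlast (by fun_prop)]
  rfl

theorem map_eval_zero_chainLaw (μ : Measure E) : (chainLaw P μ).map (fun ω => ω 0) = μ := by
  have hid : (chainKernel P).map (fun ω => ω 0) = Kernel.id := by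
    ext1 x
    rw [Kernel.map_apply _ (by fun_prop), Kernel.id_apply]
    exact map_eval_traj P 0 _
  rw [chainLaw_eq_bind, Measure.map_comp _ _ (by fun_prop), hid, Measure.id_comp]

theorem map_shift_iterate_traj (n : ℕ) (x : Finset.Iic n → E) :
    (Kernel.traj (X := fun _ : ℕ => E) (historyKernel P) n x).map shift^[n] =
      chainKernel P (x ⟨n, Finset.mem_Iic.2 le_rfl⟩) := by
  rw [← chainLaw_dirac]
  refine (isMarkovFrom_traj P n x).map_shift_iterate.ext (isMarkovFrom_chainLaw P _) ?_
  rw [map_eval_zero_chainLaw, ← map_eval_traj P n x,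
    Measure.map_map (by fun_prop) (measurable_shift.iterate n)]
  congr with ω
  simp [shift_iterate_apply]

theorem map_shift_chainLaw (μ : Measure E) [IsProbabilityMeasure μ] :
    (chainLaw P μ).map shift = chainLaw P (μ.bind P) := by
  have hμ := isMarkovFrom_chainLaw P μ
  have hshift : IsMarkovFrom P 1 (chainLaw P μ) := fun a _ => hμ a (Nat.zero_le a)
  refine hshift.map_shift_iterate.ext (isMarkovFrom_chainLaw P _) ?_
  rw [map_eval_zero_chainLaw]
  calc
    ((chainLaw P μ).map shift).map (fun ω => ω 0) = (chainLaw P μ).map fun ω => ω 1 :=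
      Measure.map_map (measurable_pi_apply 0) measurable_shift
    _ = μ.bind P := by rw [hμ.map_eval_succ, map_eval_zero_chainLaw]

theorem measurePreserving_shift {μ : Measure E} (hμ : IsInvariantProb P μ) :
    MeasurePreserving shift (chainLaw P μ) (chainLaw P μ) := by
  have := hμ.1
  exact ⟨measurable_shift, by rw [map_shift_chainLaw, hμ.2]⟩

theorem chainLaw_apply (μ : Measure E) {A : Set (ℕ → E)} (hA : MeasurableSet A) :
    chainLaw P μ A = ∫⁻ x, chainKernel P x A ∂μ := by
  rw [chainLaw_eq_bind, Measure.bind_apply hA (Kernel.aemeasurable _)]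

theorem lintegral_chainKernel_of_shift_invariant {A : Set (ℕ → E)} (hA : MeasurableSet A)
    (hinv : shift ⁻¹' A = A) (x : E) :
    ∫⁻ y, chainKernel P y A ∂(P x) = chainKernel P x A := by
  rw [← chainLaw_apply P _ hA, ← Measure.dirac_bind P.measurable x, ← map_shift_chainLaw,
    chainLaw_dirac, Measure.map_apply measurable_shift hA, hinv]

end Chain
section ZeroOne

open Preorder

variable {E : Type*} [MeasurableSpace E]

theorem iSup_piLE_eq_pi :
    ⨆ n, Filtration.piLE (X := fun _ : ℕ => E) n = MeasurableSpace.pi := by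
  refine le_antisymm (iSup_le fun n => Filtration.piLE.le n) (iSup_le fun i => ?_)
  refine le_trans ?_ (le_iSup _ i)
  rw [Filtration.piLE_eq_comap_frestrictLe]
  exact measurable_iff_comap_le.1
    ((measurable_pi_apply (⟨i, Finset.mem_Iic.2 le_rfl⟩ : Finset.Iic i)).comp
      (comap_measurable (frestrictLe (π := fun _ : ℕ => E) i)))

variable (P : Kernel E E) [IsMarkovKernel P] {A : Set (ℕ → E)}

theorem traj_apply_of_shift_invariant (hA : MeasurableSet A) (hinv : shift ⁻¹' A = A) (n : ℕ)
    (x : Finset.Iic n → E) :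
    Kernel.traj (X := fun _ : ℕ => E) (historyKernel P) n x A =
      chainKernel P (x ⟨n, Finset.mem_Iic.2 le_rfl⟩) A := by
  have hinv_iterate : shift^[n] ⁻¹' A = A := by
    rw [Set.preimage_iterate_eq, Function.iterate_fixed hinv]
  rw [← map_shift_iterate_traj, Measure.map_apply (measurable_shift.iterate n) hA, hinv_iterate]

theorem ae_tendsto_chainKernel_real (hA : MeasurableSet A) (hinv : shift ⁻¹' A = A) (x : E) :
    ∀ᵐ ω ∂(chainKernel P x),
      Tendsto (fun n => (chainKernel P (ω n)).real A) atTop (𝓝 (A.indicator 1 ω)) := by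
  let x₀ : Finset.Iic 0 → E := (MeasurableEquiv.piUnique fun _ => E).symm x
  have hint : Integrable (A.indicator (1 : (ℕ → E) → ℝ))
      (Kernel.traj (X := fun _ : ℕ => E) (historyKernel P) 0 x₀) :=
    (integrable_const (1 : ℝ)).indicator hA
  have hmeas : StronglyMeasurable[⨆ n, Filtration.piLE (X := fun _ : ℕ => E) n]
      (A.indicator (1 : (ℕ → E) → ℝ)) := by
    rw [iSup_piLE_eq_pi]
    exact (measurable_one.indicator hA).stronglyMeasurable
  have hcond := ae_all_iff.2 fun n => Kernel.condExp_traj (Nat.zero_le n) hint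
  filter_upwards [hint.tendsto_ae_condExp hmeas, hcond] with ω hlevy hcondω
  refine hlevy.congr fun n => ?_
  rw [hcondω n, integral_indicator_one hA, measureReal_def,
    traj_apply_of_shift_invariant P hA hinv, measureReal_def, frestrictLe_apply]

variable {μ : Measure E}

theorem ae_chainKernel_real_eq_indicator (hμ : IsInvariantProb P μ) (hA : MeasurableSet A)
    (hinv : shift ⁻¹' A = A) :
    ∀ᵐ ω ∂(chainLaw P μ), (chainKernel P (ω 0)).real A = A.indicator 1 ω := by
  have := hμ.1
  have hm (n : ℕ) : Measurable fun ω : ℕ → E => (chainKernel P (ω n)).real A :=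
    (Kernel.measurable_coe _ hA).ennreal_toReal.comp (measurable_pi_apply n)
  refine ae_eq_of_conservative_of_tendsto_iterate (measurePreserving_shift P hμ).conservative
    (hm 0) ?_
  simp only [shift_iterate_apply, zero_add]
  rw [chainLaw_eq_bind]
  exact Measure.ae_comp_of_ae_ae (measurableSet_tendsto_fun hm (measurable_one.indicator hA))
    (ae_of_all _ fun x => ae_tendsto_chainKernel_real P hA hinv x)

theorem ae_chainKernel_eq_zero_or_one (hμ : IsInvariantProb P μ) (hA : MeasurableSet A)
    (hinv : shift ⁻¹' A = A) : ∀ᵐ x ∂μ, chainKernel P x A = 0 ∨ chainKernel P x A = 1 := by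
  have hm := Kernel.measurable_coe (chainKernel P) hA
  have hset : MeasurableSet {x | chainKernel P x A = 0 ∨ chainKernel P x A = 1} :=
    (hm (measurableSet_singleton 0)).union (hm (measurableSet_singleton 1))
  have heval : Measurable fun ω : ℕ → E => ω 0 := measurable_pi_apply 0
  rw [← map_eval_zero_chainLaw P μ, ae_map_iff heval.aemeasurable hset]
  filter_upwards [ae_chainKernel_real_eq_indicator P hμ hA hinv] with ω hω
  by_cases h : ω ∈ A
  · exact .inr (by simpa [h, measureReal_def, ENNReal.toReal_eq_one_iff] using hω)
  · exact .inl (by simpa [h, measureReal_eq_zero_iff] using hω)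

end ZeroOne

section Absorbing

variable {E : Type*} [MeasurableSpace E] {P : Kernel E E} [IsMarkovKernel P] {μ : Measure E}

theorem invariant_restrict_of_absorbing [IsFiniteMeasure μ] (hμ : Kernel.Invariant P μ) {B : Set E}
    (hB : MeasurableSet B) (habs : ∀ x ∈ B, P x Bᶜ = 0) : Kernel.Invariant P (μ.restrict B) := by
  have hBc : (μ.restrict B).bind P Bᶜ = 0 := by
    rw [Measure.bind_apply hB.compl P.aemeasurable, lintegral_eq_zero_iff
      (Kernel.measurable_coe P hB.compl)]
    exact (ae_restrict_iff' hB).2 (ae_of_all _ habs)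
  refine Measure.eq_of_le_of_measure_univ_eq (Measure.le_iff.2 fun s hs => ?_) (by simp)
  calc
    (μ.restrict B).bind P s = (μ.restrict B).bind P (s ∩ B) :=
      (measure_inter_conull hBc).symm
    _ ≤ μ.bind P (s ∩ B) := by
      rw [Measure.bind_apply (hs.inter hB) P.aemeasurable,
        Measure.bind_apply (hs.inter hB) P.aemeasurable]
      exact lintegral_mono' Measure.restrict_le_self le_rfl
    _ = μ.restrict B s := by rw [hμ, Measure.restrict_apply hs]

theorem isInvariantProb_cond_of_absorbing (hμ : IsInvariantProb P μ) {B : Set E}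
    (hB : MeasurableSet B) (habs : ∀ x ∈ B, P x Bᶜ = 0) (hpos : μ B ≠ 0) :
    IsInvariantProb P μ[|B] := by
  have := hμ.1
  refine ⟨cond_isProbabilityMeasure hpos, ?_⟩
  rw [Kernel.Invariant, ProbabilityTheory.cond, Measure.comp_smul,
    invariant_restrict_of_absorbing hμ.2 hB habs]

theorem measure_compl_setOf_chainKernel_eq_one {A : Set (ℕ → E)} (hA : MeasurableSet A)
    (hinv : shift ⁻¹' A = A) {x : E} (hx : chainKernel P x A = 1) :
    P x {y | chainKernel P y A = 1}ᶜ = 0 := by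
  have hone : (fun y => chainKernel P y A) =ᵐ[P x] fun _ => 1 := by
    refine ae_eq_of_ae_le_of_lintegral_le (ae_of_all _ fun y => prob_le_one) ?_
      aemeasurable_const ?_
    · rw [lintegral_chainKernel_of_shift_invariant P hA hinv, hx]
      exact ENNReal.one_ne_top
    · rw [lintegral_chainKernel_of_shift_invariant P hA hinv, hx]
      simp
  exact hone

theorem exists_mutuallySingular_of_not_ergodic (hμ : IsInvariantProb P μ)
    (hnot : ¬ Ergodic shift (chainLaw P μ)) :
    ∃ σ ρ, IsInvariantProb P σ ∧ IsInvariantProb P ρ ∧ σ ⟂ₘ ρ := by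
  obtain ⟨A, hA, hinv, hAμ⟩ : ∃ A, MeasurableSet A ∧ shift ⁻¹' A = A ∧
      ¬ EventuallyConst A (ae (chainLaw P μ)) := by
    by_contra! h
    exact hnot ⟨measurePreserving_shift P hμ, ⟨fun A hA hinv => h A hA hinv⟩⟩
  let H (A : Set (ℕ → E)) : Set E := {x | chainKernel P x A = 1}
  have hH {A : Set (ℕ → E)} (hA : MeasurableSet A) : MeasurableSet (H A) :=
    Kernel.measurable_coe (chainKernel P) hA (measurableSet_singleton 1)
  have hcond {A : Set (ℕ → E)} (hA : MeasurableSet A) (hinv : shift ⁻¹' A = A)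
      (hne : chainLaw P μ A ≠ 0) : IsInvariantProb P μ[|H A] := by
    refine isInvariantProb_cond_of_absorbing hμ (hH hA)
      (fun x hx => measure_compl_setOf_chainKernel_eq_one hA hinv hx) fun h0 => hne ?_
    rw [chainLaw_apply P μ hA, lintegral_eq_zero_iff (Kernel.measurable_coe _ hA)]
    filter_upwards [ae_chainKernel_eq_zero_or_one P hμ hA hinv,
      measure_eq_zero_iff_ae_notMem.1 h0] with x hx hxH
    exact hx.resolve_right hxH
  have hdisj : H A ⊆ (H Aᶜ)ᶜ := fun x (hx : chainKernel P x A = 1) hxc =>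
    zero_ne_one (((prob_compl_eq_zero_iff hA).2 hx).symm.trans hxc)
  rw [eventuallyConst_set, not_or] at hAμ
  refine ⟨μ[|H A], μ[|H Aᶜ], hcond hA hinv fun h => hAμ.2 (measure_eq_zero_iff_ae_notMem.1 h),
    hcond hA.compl (by rw [Set.preimage_compl, hinv]) hAμ.1, (H A)ᶜ, (hH hA).compl, ?_, ?_⟩
  · simp [cond_apply (hH hA)]
  · rw [compl_compl]
    exact measure_mono_null hdisj (by simp [cond_apply (hH hA.compl)])

end Absorbing

section Confinement

variable {E : Type*} [MeasurableSpace E] (P : Kernel E E) [IsMarkovKernel P] {μ : Measure E}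

theorem ae_exists_chainKernel_eq_zero {ι : Type*} [Countable ι] (hμ : IsInvariantProb P μ)
    {A : ι → Set (ℕ → E)} (hA : ∀ i, MeasurableSet (A i)) (hinv : ∀ i, shift ⁻¹' A i = A i)
    (hnull : chainLaw P μ (⋂ i, A i) = 0) : ∀ᵐ x ∂μ, ∃ i, chainKernel P x (A i) = 0 := by
  rw [chainLaw_eq_bind] at hnull
  filter_upwards [Measure.ae_ae_of_ae_comp (measure_eq_zero_iff_ae_notMem.1 hnull),
    ae_all_iff.2 fun i => ae_chainKernel_eq_zero_or_one P hμ (hA i) (hinv i)] with x hx h01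
  by_contra! hne
  have hone (i : ι) : ∀ᵐ ω ∂(chainKernel P x), ω ∈ A i :=
    (mem_ae_iff_prob_eq_one (hA i)).2 ((h01 i).resolve_left (hne i))
  obtain ⟨ω, hω, hωA⟩ := (hx.and (ae_all_iff.2 hone)).exists
  exact hω (Set.mem_iInter.2 hωA)

theorem ae_exists_isCompact_upperFrequency_le [TopologicalSpace E] [PolishSpace E] [BorelSpace E]
    (hμ : IsInvariantProb P μ) {S : Set E} (hS : MeasurableSet S) (hμS : μ Sᶜ = 0) {c : ℝ≥0}
    (hc : 0 < c) :
    ∀ᵐ x ∂μ, ∃ K ⊆ S, IsCompact K ∧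
      ∀ᵐ ω ∂(chainKernel P x), upperFrequency shift {ω | ω 0 ∈ Kᶜ} ω ≤ c := by
  have := hμ.1
  have heval : Measurable fun ω : ℕ → E => ω 0 := measurable_pi_apply 0
  choose K hKS hK hμK using fun m : ℕ => hS.exists_isCompact_sdiff_lt (measure_ne_top μ S)
    (ENNReal.inv_ne_zero.2 (ENNReal.natCast_ne_top m))
  have hKm (m : ℕ) : MeasurableSet {ω : ℕ → E | ω 0 ∈ (K m)ᶜ} := heval (hK m).measurableSet.compl
  let A (m : ℕ) : Set (ℕ → E) := {ω | c < upperFrequency shift {ω | ω 0 ∈ (K m)ᶜ} ω}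
  have measure_le (m : ℕ) : c * chainLaw P μ (⋂ m, A m) ≤ (m : ℝ≥0∞)⁻¹ := calc
    c * chainLaw P μ (⋂ m, A m) ≤ c * chainLaw P μ (A m) := by
      gcongr
      exact Set.iInter_subset A m
    _ ≤ chainLaw P μ {ω | ω 0 ∈ (K m)ᶜ} :=
      mul_measure_lt_upperFrequency_le (measurePreserving_shift P hμ) (hKm m) c
    _ = μ (K m)ᶜ := by
      conv_rhs => rw [← map_eval_zero_chainLaw P μ]
      exact (Measure.map_apply heval (hK m).measurableSet.compl).symm
    _ = μ (S \ K m) := by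
      rw [Set.sdiff_eq, Set.inter_comm, measure_inter_conull hμS]
    _ ≤ (m : ℝ≥0∞)⁻¹ := (hμK m).le
  have hnull : chainLaw P μ (⋂ m, A m) = 0 := by
    have h0 := ge_of_tendsto' ENNReal.tendsto_inv_nat_nhds_zero measure_le
    exact (mul_eq_zero.1 (le_antisymm h0 zero_le)).resolve_left (by simpa using hc.ne')
  filter_upwards [ae_exists_chainKernel_eq_zero P hμ (fun m =>
      measurableSet_lt measurable_const (measurable_upperFrequency measurable_shift (hKm m)))
    (fun m => Set.ext fun ω => by simp [upperFrequency_comp]) hnull] with x ⟨m, hm⟩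
  refine ⟨K m, hKS m, hK m, ?_⟩
  filter_upwards [measure_eq_zero_iff_ae_notMem.1 hm] with ω hω using not_lt.1 hω

end Confinement

section Coupling

variable {Ω : Type*} [MeasurableSpace Ω]

theorem eventually_average_measureReal_lt {Q : Measure Ω} [IsProbabilityMeasure Q] {T : Ω → Ω}
    (hT : Measurable T) {D : Set Ω} (hD : MeasurableSet D) {c b : ℝ≥0} (hcb : c < b)
    (hfreq : ∀ᵐ ω ∂Q, upperFrequency T D ω ≤ c) :
    ∀ᶠ n : ℕ in atTop, 1 / (n : ℝ) * ∑ i ∈ Finset.range n, Q.real (T^[i] ⁻¹' D) < b := by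
  have hlimsup : limsup (fun n : ℕ => (∑ i ∈ Finset.range n, Q (T^[i] ⁻¹' D)) / n) atTop < b := calc
    _ ≤ ∫⁻ ω, upperFrequency T D ω ∂Q := limsup_average_measure_le_lintegral_upperFrequency hT hD
    _ ≤ ∫⁻ _, c ∂Q := lintegral_mono_ae hfreq
    _ < b := by simpa using hcb
  filter_upwards [eventually_lt_of_limsup_lt hlimsup] with n hn
  simpa [measureReal_def, ENNReal.toReal_sum, div_eq_inv_mul] using
    ENNReal.toReal_strict_mono ENNReal.coe_ne_top hn

theorem measureReal_le_map_fst_add_map_snd {Ω' : Type*} [MeasurableSpace Ω']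
    {ξ : Measure (Ω × Ω')} [IsFiniteMeasure ξ] {A : Set Ω} {B : Set Ω'} (hA : MeasurableSet A)
    (hB : MeasurableSet B) {C : Set (Ω × Ω')} (hC : C ⊆ Prod.fst ⁻¹' A ∪ Prod.snd ⁻¹' B) :
    ξ.real C ≤ (ξ.map Prod.fst).real A + (ξ.map Prod.snd).real B := by
  rw [map_measureReal_apply measurable_fst hA, map_measureReal_apply measurable_snd hB]
  exact (measureReal_mono hC).trans (measureReal_union_le _ _)

variable {E : Type*} {d : E → E → ℝ} {K L : Set E}

theorem limsup_average_coupling_le [MeasurableSpace E] {Q₁ Q₂ : Measure (ℕ → E)}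
    {ξ : Measure ((ℕ → E) × (ℕ → E))} (hξ : ξ ∈ generalizedCouplings Q₁ Q₂)
    (hK : MeasurableSet K) (hL : MeasurableSet L) {ε : ℝ} (hKL : ∀ x ∈ K, ∀ y ∈ L, ε < d x y)
    {c : ℝ≥0} (hQ₁ : ∀ᵐ ω ∂Q₁, upperFrequency shift {ω | ω 0 ∈ Kᶜ} ω ≤ c)
    (hQ₂ : ∀ᵐ ω ∂Q₂, upperFrequency shift {ω | ω 0 ∈ Lᶜ} ω ≤ c) :
    limsup (fun n : ℕ => (1 / (n : ℝ)) * ∑ i ∈ Finset.range n,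
      ξ.real {ω : (ℕ → E) × (ℕ → E) | d (ω.1 i) (ω.2 i) ≤ ε}) atTop ≤ 2 * c := by
  obtain ⟨hprob, hfst, hsnd⟩ := hξ
  have := Measure.isProbabilityMeasure_map (μ := ξ) measurable_fst.aemeasurable
  have := Measure.isProbabilityMeasure_map (μ := ξ) measurable_snd.aemeasurable
  have hKc : MeasurableSet {ω : ℕ → E | ω 0 ∈ Kᶜ} := measurable_pi_apply 0 hK.compl
  have hLc : MeasurableSet {ω : ℕ → E | ω 0 ∈ Lᶜ} := measurable_pi_apply 0 hL.compl
  have hclose (i : ℕ) : ξ.real {ω | d (ω.1 i) (ω.2 i) ≤ ε} ≤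
      (ξ.map Prod.fst).real (shift^[i] ⁻¹' {ω | ω 0 ∈ Kᶜ}) +
        (ξ.map Prod.snd).real (shift^[i] ⁻¹' {ω | ω 0 ∈ Lᶜ}) := by
    refine measureReal_le_map_fst_add_map_snd (measurable_shift.iterate i hKc)
      (measurable_shift.iterate i hLc) fun ω (hω : d (ω.1 i) (ω.2 i) ≤ ε) => ?_
    by_contra hfar
    simp only [Set.mem_union, Set.mem_preimage, Set.mem_ofPred_eq, shift_iterate_apply, zero_add,
      Set.mem_compl_iff, not_or, not_not] at hfar
    exact (hKL _ hfar.1 _ hfar.2).not_ge hω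
  refine le_of_forall_pos_le_add fun δ hδ => limsup_le_of_le
    (isCoboundedUnder_le_of_le atTop (x := 0) fun n => by positivity) ?_
  lift δ to ℝ≥0 using hδ.le
  have hcδ : c < c + δ / 2 := lt_add_of_pos_right c (half_pos (mod_cast hδ))
  filter_upwards [eventually_average_measureReal_lt measurable_shift hKc hcδ (hfst.ae_le hQ₁),
    eventually_average_measureReal_lt measurable_shift hLc hcδ (hsnd.ae_le hQ₂)] with n hnK hnL
  calc
    _ ≤ 1 / (n : ℝ) * ∑ i ∈ Finset.range n, (_ + _) := by gcongr with i; exact hclose i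
    _ ≤ 2 * c + δ := by
      rw [Finset.sum_add_distrib, mul_add]
      push_cast at hnK hnL
      linarith

theorem exists_pos_forall_lt_of_disjoint [TopologicalSpace E]
    (hd : LowerSemicontinuous fun p : E × E => d p.1 p.2) (hpos : ∀ x y, x ≠ y → 0 < d x y)
    (hK : IsCompact K) (hL : IsCompact L) (hKL : Disjoint K L) :
    ∃ ε > 0, ∀ x ∈ K, ∀ y ∈ L, ε < d x y := by
  obtain hempty | hne := (K ×ˢ L).eq_empty_or_nonempty
  · exact ⟨1, one_pos, fun x hx y hy => absurd (Set.mk_mem_prod hx hy) (by simp [hempty])⟩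
  obtain ⟨p, hp, hmin⟩ := (hd.lowerSemicontinuousOn _).exists_isMinOn hne (hK.prod hL)
  have hdp : 0 < d p.1 p.2 := hpos _ _ (hKL.ne_of_mem hp.1 hp.2)
  exact ⟨d p.1 p.2 / 2, half_pos hdp, fun x hx y hy =>
    (half_lt_self hdp).trans_le (hmin (Set.mk_mem_prod hx hy))⟩

end Coupling

section Uniqueness

variable {E : Type*} [MeasurableSpace E] {P : Kernel E E} {μ ν : Measure E}

theorem IsInvariantProb.midpoint (hμ : IsInvariantProb P μ) (hν : IsInvariantProb P ν) :
    IsInvariantProb P ((2 : ℝ≥0∞)⁻¹ • (μ + ν)) := by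
  have := hμ.1
  have := hν.1
  refine ⟨⟨?_⟩, ?_⟩
  · simp [ENNReal.inv_two_add_inv_two]
  · rw [Kernel.Invariant, Measure.comp_smul, Measure.comp_add, hμ.2, hν.2]

variable (P) [IsMarkovKernel P]

/-- The chains started at `x` and `y` are asymptotically coupled: for every `ε`, some generalized
coupling of them keeps them within `d`-distance `ε` for an upper fraction of the time of at least
`α > 0`. The bound `α` may depend on `x` and `y` but not on `ε`. -/
def IsAsymptoticallyCoupled (d : E → E → ℝ) (x y : E) : Prop :=
  ∃ α : ℝ, 0 < α ∧ ∀ ε : ℝ, 0 < ε →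
    ∃ ξ ∈ generalizedCouplings (chainLaw P (Measure.dirac x)) (chainLaw P (Measure.dirac y)),
      α ≤ limsup (fun n : ℕ => (1 / (n : ℝ)) * ∑ i ∈ Finset.range n,
        ξ.real {ω : (ℕ → E) × (ℕ → E) | d (ω.1 i) (ω.2 i) ≤ ε}) atTop

variable {P}

theorem not_mutuallySingular_of_isAsymptoticallyCoupled [TopologicalSpace E] [PolishSpace E]
    [BorelSpace E] {d : E → E → ℝ} (hd : LowerSemicontinuous fun p : E × E => d p.1 p.2)
    (hpos : ∀ x y, x ≠ y → 0 < d x y) {M : Set E}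
    (hcoupling : ∀ x ∈ M, ∀ y ∈ M, IsAsymptoticallyCoupled P d x y)
    (hμ : IsInvariantProb P μ) (hν : IsInvariantProb P ν) (hμM : μ M ≠ 0) (hνM : ν M ≠ 0) :
    ¬ μ ⟂ₘ ν := by
  rintro ⟨S, hS, hμS, hνS⟩
  have exists_confined {ρ : Measure E} (hρ : IsInvariantProb P ρ) (hρM : ρ M ≠ 0) {S : Set E}
      (hS : MeasurableSet S) (hρS : ρ Sᶜ = 0) : ∃ x ∈ M, ∀ k : ℕ, ∃ K ⊆ S, IsCompact K ∧
        ∀ᵐ ω ∂(chainKernel P x),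
          upperFrequency shift {ω | ω 0 ∈ Kᶜ} ω ≤ (1 / (k + 1) : ℝ≥0) :=
    ((frequently_ae_mem_iff.2 hρM).and_eventually (ae_all_iff.2 fun k =>
      ae_exists_isCompact_upperFrequency_le P hρ hS hρS (by positivity))).exists
  obtain ⟨x, hxM, hx⟩ := exists_confined hμ hμM hS.compl (by rwa [compl_compl])
  obtain ⟨y, hyM, hy⟩ := exists_confined hν hνM hS hνS
  obtain ⟨α, hα, hξ⟩ := hcoupling x hxM y hyM
  obtain ⟨k, hk⟩ := exists_nat_one_div_lt (half_pos hα)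
  obtain ⟨K, hKS, hK, hxK⟩ := hx k
  obtain ⟨L, hLS, hL, hyL⟩ := hy k
  obtain ⟨ε, hε, hKL⟩ := exists_pos_forall_lt_of_disjoint hd hpos hK hL
    (Set.disjoint_of_subset hKS hLS disjoint_compl_left)
  obtain ⟨ξ, hξmem, hξα⟩ := hξ ε hε
  rw [chainLaw_dirac, chainLaw_dirac] at hξmem
  have hle := limsup_average_coupling_le hξmem hK.measurableSet hL.measurableSet hKL hxK hyL
  push_cast at hle
  linarith

theorem eq_of_absolutelyContinuous_of_ergodic (hμ : IsInvariantProb P μ)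
    (hν : IsInvariantProb P ν) (hνμ : ν ≪ μ) (herg : Ergodic shift (chainLaw P μ)) : ν = μ := by
  have := hμ.1
  have := hν.1
  have hchain : chainLaw P ν ≪ chainLaw P μ := by
    rw [chainLaw_eq_bind, chainLaw_eq_bind]
    exact hνμ.comp_right _
  rw [← map_eval_zero_chainLaw P ν, ← map_eval_zero_chainLaw P μ,
    herg.eq_of_absolutelyContinuous (measurePreserving_shift P hν) hchain]

theorem eq_of_forall_ergodic
    (herg : ∀ μ : Measure E, IsInvariantProb P μ → Ergodic shift (chainLaw P μ))
    (hμ : IsInvariantProb P μ) (hν : IsInvariantProb P ν) : μ = ν := by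
  have hmid := hμ.midpoint hν
  have eq_midpoint {ρ : Measure E} (hρ : IsInvariantProb P ρ) (hac : ρ ≪ μ + ν) :
      ρ = (2 : ℝ≥0∞)⁻¹ • (μ + ν) :=
    eq_of_absolutelyContinuous_of_ergodic hmid hρ
      (hac.trans (Measure.absolutelyContinuous_smul (by simp))) (herg _ hmid)
  have hμac : μ ≪ μ + ν := Measure.AbsolutelyContinuous.rfl.add_right ν
  have hνac : ν ≪ μ + ν := add_comm ν μ ▸ Measure.AbsolutelyContinuous.rfl.add_right μ
  exact (eq_midpoint hμ hμac).trans (eq_midpoint hν hνac).symm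

end Uniqueness

end GenCoupling

theorem corollary2p2_general {E : Type*} [TopologicalSpace E] [PolishSpace E] [MeasurableSpace E]
    [BorelSpace E] (P : Kernel E E) [IsMarkovKernel P]
    (d : E → E → ℝ) (hd : LowerSemicontinuous fun p : E × E => d p.1 p.2)
    (hpos : ∀ x y, x ≠ y → 0 < d x y) (M : Set E)
    (hMpos : ∀ μ : Measure E, GenCoupling.IsInvariantProb P μ → 0 < μ M)
    (hcoupling : ∀ x ∈ M, ∀ y ∈ M, GenCoupling.IsAsymptoticallyCoupled P d x y) :
    (∀ μ ν : Measure E, GenCoupling.IsInvariantProb P μ → GenCoupling.IsInvariantProb P ν →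
      μ = ν) ∧
    (∀ μ : Measure E, GenCoupling.IsInvariantProb P μ →
      Ergodic GenCoupling.shift (GenCoupling.chainLaw P μ)) := by
  have herg (μ : Measure E) (hμ : GenCoupling.IsInvariantProb P μ) :
      Ergodic GenCoupling.shift (GenCoupling.chainLaw P μ) := by
    by_contra hnot
    obtain ⟨σ, ρ, hσ, hρ, hσρ⟩ := GenCoupling.exists_mutuallySingular_of_not_ergodic hμ hnot
    exact GenCoupling.not_mutuallySingular_of_isAsymptoticallyCoupled hd hpos hcoupling hσ hρ
      (hMpos σ hσ).ne' (hMpos ρ hρ).ne' hσρ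
  exact ⟨fun _ _ hμ hν => GenCoupling.eq_of_forall_ergodic herg hμ hν, herg⟩

theorem corollary2p2 {E : Type*} [TopologicalSpace E] [PolishSpace E] [MeasurableSpace E]
    [BorelSpace E] (P : Kernel E E) [IsMarkovKernel P]
    (d : E → E → ℝ) (hd : GenCoupling.IsContinuousMetric d)
    (M : Set E) (hM : MeasurableSet M)
    (hMpos : ∀ μ : Measure E, GenCoupling.IsInvariantProb P μ → 0 < μ M)
    (hcoupling : ∀ x ∈ M, ∀ y ∈ M, ∃ α : ℝ, 0 < α ∧ ∀ ε : ℝ, 0 < ε →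
      ∃ ξ ∈ GenCoupling.generalizedCouplings
          (GenCoupling.chainLaw P (Measure.dirac x)) (GenCoupling.chainLaw P (Measure.dirac y)),
        α ≤ limsup (fun n : ℕ => (1 / (n : ℝ)) *
          ∑ i ∈ Finset.range n,
            ξ.real {ω : (ℕ → E) × (ℕ → E) | d (ω.1 i) (ω.2 i) ≤ ε}) atTop) :
    (∀ μ ν : Measure E, GenCoupling.IsInvariantProb P μ → GenCoupling.IsInvariantProb P ν →
      μ = ν) ∧
    (∀ μ : Measure E, GenCoupling.IsInvariantProb P μ →
      Ergodic GenCoupling.shift (GenCoupling.chainLaw P μ)) :=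
  corollary2p2_general P d hd.continuous.lowerSemicontinuous
    (fun x y hxy => (hd.nonneg x y).lt_of_ne fun h => hxy ((hd.eq_zero_iff x y).1 h.symm))
    M hMpos hcoupling
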